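/- **Setting.** A *field* on a set $X$ is a family of subsets of $X$ containing $X$ and closed under complements and finite intersections. For a field $\mathcal A$ on $X$, $\mathrm{pba}(X,\mathcal A)$ is the set of probability charges, i.e. finitely additive $\mu:\mathcal A\to[0,\infty)$ with $\mu(X)=1$, and $B(X,\mathcal A)$ is the set of uniform limits of finite linear combinations of characteristic functions of members of $\mathcal A$; every $f\in B(X,\mathcal A)$ has an integral $\int f\,d\mu$ with respect to every $\mu\in\mathrm{pba}(X,\mathcal A)$. A *type space* $T=((\Omega,\mathcal A),(\Omega,\mathcal M_i)_{i\in N},(t_i)_{i\in N})$ consists of a set $\Omega$ of states, a set $N$ of players, a field $\mathcal A$ on $\Omega$, for each $i\in N$ a field $\mathcal M_i\subseteq\mathcal A$ on $\Omega$, and for each $i\in N$ a function $t_i:\Omega\times\mathcal A\to[0,1]$ such that $t_i(\omega,\cdot)\in\mathrm{pba}(\Omega,\mathcal A)$ for all $\omega\in\Omega$, $t_i(\cdot,E)\in B(\Omega,\mathcal M_i)$ for all $E\in\mathcal A$, and $t_i(\omega,E)=1$ whenever $\omega\in E\in\mathcal M_i$. Let $$\Pi_i=\Big\{P\in\mathrm{pba}(\Omega,\mathcal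 A): P(E\cap F)=\int_F t_i(\cdot,E)\,dP\ \text{ for all } E\in\mathcal A,\ F\in\mathcal M_i\Big\}.$$ For $I\subseteq N$, a nonempty set $S\subseteq\Omega$ (not necessarily in $\mathcal A$) is an *$I$-common certainty component* if there is $E\in\mathcal A$ with $E\subseteq S$ and $t_i(\omega,E)=1$ for all $\omega\in S$ and $i\in I$. A set $A\subseteq\Omega$ is *$I$-commonly certain* at $\omega$ if there is an $I$-common certainty component $S$ with $\omega\in S\subseteq A$. The players' beliefs are *universally consistent* if for every finite $I\subseteq N$ and every $I$-common certainty component $S$ there is $P\in\bigcap_{i\in I}\Pi_i$ with $\inf\{P(E): S\subseteq E\in\mathcal A\}>0$ (for $I=\emptyset$ the intersection is $\mathrm{pba}(\Omega,\mathcal A)$). A *bet* is a family $(f_i)_{i\in I}$ of functions $f_i\in B(\Omega,\mathcal A)$, indexed by a finite nonempty $I\subseteq N$, with $\sum_{i\in I}f_i(\omega)=0$ for all $\omega\in\Omega$. It is *weakly agreeable* if at every state $\omega\in\Omega$ the set $\{\omega':\int f_i\,dt_i(\omega',\cdot)\ge 0\ \ \forall i\in I\}$ is $I$-commonly certain, and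 there are $\omega\in\Omega$ and $\alpha>0$ such that at $\omega$ the set $\{\omega':\int f_i\,dt_i(\omega',\cdot)\ge\alpha\ \ \forall i\in I\}$ is $I$-commonly certain. **Theorem.** Let $T$ be a type space. Then exactly one of the following holds: (a) the players' beliefs in $T$ are universally consistent; (b) there exists a weakly agreeable bet in $T$. That is, the beliefs are universally consistent if and only if there is no weakly agreeable bet. -/

import Mathlib

open Set Filter Topology MeasureTheory

noncomputable section

namespace BeliefConsistency

/-! ### Probability charges and integrable functions on a field of sets

A field of sets is Mathlib's `IsSetAlgebra`, and a (finitely additive, real valued) charge on it is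
Mathlib's `AddContent ℝ 𝒜`. -/

section Charges

variable {X : Type*} {𝒜 : Set (Set X)}

/-- The probability charges on `(X, 𝒜)`. -/
def pba (𝒜 : Set (Set X)) : Set (AddContent ℝ 𝒜) :=
  {μ | (∀ A ∈ 𝒜, 0 ≤ μ A) ∧ μ univ = 1}

/-- Finite linear combinations of characteristic functions of members of `𝒜`. -/
def simpleFunctions (𝒜 : Set (Set X)) : Submodule ℝ (X → ℝ) :=
  Submodule.span ℝ {g | ∃ A ∈ 𝒜, g = A.indicator 1}

/-- `B(X, 𝒜)`: uniform limits of finite linear combinations of characteristic functions of members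
of `𝒜`; its members are called `𝒜`-integrable. -/
def integrableFunctions (𝒜 : Set (Set X)) : Set (X → ℝ) :=
  {f | ∃ s : ℕ → X → ℝ, (∀ n, s n ∈ simpleFunctions 𝒜) ∧ TendstoUniformly s f atTop}

/-- The integral of a simple function: the sum of its values, each weighted by the charge of the
set where it is attained (finitely many terms are nonzero). -/
def simpleIntegral (μ : AddContent ℝ 𝒜) (s : X → ℝ) : ℝ :=
  ∑ᶠ r : ℝ, r * μ (s ⁻¹' {r})

/-- The integral with respect to a probability charge: the supremum of the integrals of the simple
functions below `f`. On `integrableFunctions 𝒜` it is the limit of the integrals of any uniformly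
approximating sequence of simple functions (`tendsto_simpleIntegral`). -/
def chargeIntegral (μ : AddContent ℝ 𝒜) (f : X → ℝ) : ℝ :=
  sSup {c | ∃ s ∈ simpleFunctions 𝒜, (∀ x, s x ≤ f x) ∧ c = simpleIntegral μ s}

/-- The outer weight `inf {P(E) : S ⊆ E ∈ 𝒜}` of an arbitrary set `S`. -/
def outerWeight (P : AddContent ℝ 𝒜) (S : Set X) : ℝ :=
  sInf {c | ∃ E ∈ 𝒜, S ⊆ E ∧ c = P E}

/-! Sanity facts: the integral of a simple function is the expected one, and `chargeIntegral`
extends it by uniform limits. -/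

theorem preimage_mem_of_simple (h𝒜 : IsSetAlgebra 𝒜) {s : X → ℝ} (hs : s ∈ simpleFunctions 𝒜) :
    (range s).Finite ∧ ∀ r, s ⁻¹' {r} ∈ 𝒜 := by
  classical
  have key : ∀ (s t : X → ℝ) (op : ℝ → ℝ → ℝ), ((range s).Finite ∧ ∀ r, s ⁻¹' {r} ∈ 𝒜) →
      ((range t).Finite ∧ ∀ r, t ⁻¹' {r} ∈ 𝒜) →
      ((range fun x => op (s x) (t x)).Finite ∧
        ∀ r, (fun x => op (s x) (t x)) ⁻¹' {r} ∈ 𝒜) := by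
    intro s t op hs ht
    refine ⟨((hs.1.prod ht.1).image fun p => op p.1 p.2).subset ?_, fun r => ?_⟩
    · rintro _ ⟨x, rfl⟩
      exact ⟨(s x, t x), ⟨⟨x, rfl⟩, ⟨x, rfl⟩⟩, rfl⟩
    · have : (fun x => op (s x) (t x)) ⁻¹' {r} =
          ⋃ p ∈ ((hs.1.prod ht.1).toFinset.filter fun p => op p.1 p.2 = r),
            (s ⁻¹' {p.1} ∩ t ⁻¹' {p.2}) := by
        ext x
        simp only [mem_preimage, mem_singleton_iff, Finset.mem_filter, Finite.mem_toFinset,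
          mem_prod, mem_range, mem_iUnion, mem_inter_iff, exists_prop, Prod.exists]
        exact ⟨fun h => ⟨s x, t x, ⟨⟨⟨x, rfl⟩, ⟨x, rfl⟩⟩, h⟩, rfl, rfl⟩,
          fun ⟨a, b, ⟨_, h⟩, ha, hb⟩ => by rw [ha, hb]; exact h⟩
      rw [this]
      exact h𝒜.biUnion_mem _ fun p _ => h𝒜.inter_mem (hs.2 _) (ht.2 _)
  have hconst : ∀ c : ℝ, (range fun _ : X => c).Finite ∧ ∀ r, (fun _ : X => c) ⁻¹' {r} ∈ 𝒜 := by
    intro c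
    refine ⟨(finite_singleton c).subset (by rintro _ ⟨x, rfl⟩; rfl), fun r => ?_⟩
    by_cases h : c = r
    · simpa [preimage, h] using h𝒜.univ_mem
    · simpa [preimage, h] using h𝒜.empty_mem
  induction hs using Submodule.span_induction with
  | mem g hg =>
    obtain ⟨A, hA, rfl⟩ := hg
    refine ⟨(toFinite {0, 1}).subset ?_, fun r => ?_⟩
    · rintro _ ⟨x, rfl⟩
      by_cases h : x ∈ A <;> simp [h]
    · by_cases h1 : r = 1
      · have : A.indicator (1 : X → ℝ) ⁻¹' {r} = A := by
          ext x; by_cases h : x ∈ A <;> simp [h, h1]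
        rwa [this]
      by_cases h0 : r = 0
      · have : A.indicator (1 : X → ℝ) ⁻¹' {r} = Aᶜ := by
          ext x; by_cases h : x ∈ A <;> simp [h, h0]
        rw [this]; exact h𝒜.compl_mem hA
      · have : A.indicator (1 : X → ℝ) ⁻¹' {r} = ∅ := by
          ext x; by_cases h : x ∈ A <;> simp [h, Ne.symm h1, Ne.symm h0]
        rw [this]; exact h𝒜.empty_mem
  | zero => exact hconst 0
  | add s t _ _ hs ht => exact key s t (· + ·) hs ht
  | smul c s _ hs => exact key _ s (· * ·) (hconst c) hs

theorem simpleIntegral_pair (h𝒜 : IsSetAlgebra 𝒜) (μ : AddContent ℝ 𝒜) {s t u : X → ℝ}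
    (hs : s ∈ simpleFunctions 𝒜) (ht : t ∈ simpleFunctions 𝒜) (φ : ℝ → ℝ → ℝ)
    (hu : ∀ x, u x = φ (s x) (t x)) :
    simpleIntegral μ u =
      ∑ p ∈ (((preimage_mem_of_simple h𝒜 hs).1.prod (preimage_mem_of_simple h𝒜 ht).1).toFinset),
        φ p.1 p.2 * μ (s ⁻¹' {p.1} ∩ t ⁻¹' {p.2}) := by
  classical
  obtain ⟨hsf, hsm⟩ := preimage_mem_of_simple h𝒜 hs
  obtain ⟨htf, htm⟩ := preimage_mem_of_simple h𝒜 ht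
  set F := (hsf.prod htf).toFinset with hF
  have hpre : ∀ r, u ⁻¹' {r} =
      ⋃ p ∈ F.filter (fun p : ℝ × ℝ => φ p.1 p.2 = r), (s ⁻¹' {p.1} ∩ t ⁻¹' {p.2}) := by
    intro r
    ext x
    simp only [hF, mem_preimage, mem_singleton_iff, Finset.mem_filter, Finite.mem_toFinset,
      mem_prod, mem_range, mem_iUnion, mem_inter_iff, exists_prop, Prod.exists, hu]
    exact ⟨fun h => ⟨s x, t x, ⟨⟨⟨x, rfl⟩, ⟨x, rfl⟩⟩, h⟩, rfl, rfl⟩,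
      fun ⟨a, b, ⟨_, h⟩, ha, hb⟩ => by rw [ha, hb]; exact h⟩
  have hval : ∀ r, μ (u ⁻¹' {r}) =
      ∑ p ∈ F.filter (fun p : ℝ × ℝ => φ p.1 p.2 = r), μ (s ⁻¹' {p.1} ∩ t ⁻¹' {p.2}) := by
    intro r
    rw [hpre r]
    refine addContent_biUnion (fun p _ => h𝒜.inter_mem (hsm _) (htm _)) ?_
      (h𝒜.biUnion_mem _ fun p _ => h𝒜.inter_mem (hsm _) (htm _))
    intro p _ q _ hpq
    refine Set.disjoint_left.2 fun x hx hx' => hpq ?_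
    simp only [mem_inter_iff, mem_preimage, mem_singleton_iff] at hx hx'
    exact Prod.ext (hx.1.symm.trans hx'.1) (hx.2.symm.trans hx'.2)
  unfold simpleIntegral
  rw [finsum_eq_sum_of_support_subset (s := F.image fun p : ℝ × ℝ => φ p.1 p.2)]
  · simp_rw [hval, Finset.mul_sum]
    rw [← Finset.sum_fiberwise_of_maps_to (g := fun p : ℝ × ℝ => φ p.1 p.2)
      (fun p hp => Finset.mem_image_of_mem _ hp)]
    refine Finset.sum_congr rfl fun r _ => Finset.sum_congr rfl fun p hp => ?_
    rw [(Finset.mem_filter.1 hp).2]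
  · intro r hr
    by_contra hcon
    apply hr
    have : F.filter (fun p : ℝ × ℝ => φ p.1 p.2 = r) = ∅ := by
      rw [Finset.filter_eq_empty_iff]
      intro p hp hpr
      exact hcon (Finset.mem_coe.2 (Finset.mem_image.2 ⟨p, hp, hpr⟩))
    simp [hval, this]

theorem simpleIntegral_add (h𝒜 : IsSetAlgebra 𝒜) (μ : AddContent ℝ 𝒜) {s t : X → ℝ}
    (hs : s ∈ simpleFunctions 𝒜) (ht : t ∈ simpleFunctions 𝒜) :
    simpleIntegral μ (s + t) = simpleIntegral μ s + simpleIntegral μ t := by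
  rw [simpleIntegral_pair h𝒜 μ hs ht (fun a b => a + b) (u := s + t) fun _ => rfl,
    simpleIntegral_pair h𝒜 μ hs ht (fun a _ => a) (u := s) fun _ => rfl,
    simpleIntegral_pair h𝒜 μ hs ht (fun _ b => b) (u := t) fun _ => rfl,
    ← Finset.sum_add_distrib]
  exact Finset.sum_congr rfl fun p _ => by ring

theorem simpleIntegral_smul (h𝒜 : IsSetAlgebra 𝒜) (μ : AddContent ℝ 𝒜) {s : X → ℝ}
    (hs : s ∈ simpleFunctions 𝒜) (c : ℝ) :
    simpleIntegral μ (c • s) = c * simpleIntegral μ s := by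
  rw [simpleIntegral_pair h𝒜 μ hs hs (fun a _ => c * a) (u := c • s) fun _ => rfl,
    simpleIntegral_pair h𝒜 μ hs hs (fun a _ => a) (u := s) fun _ => rfl, Finset.mul_sum]
  exact Finset.sum_congr rfl fun p _ => by ring

theorem simpleIntegral_indicator (μ : AddContent ℝ 𝒜) (A : Set X) :
    simpleIntegral μ (A.indicator 1) = μ A := by
  unfold simpleIntegral
  rw [finsum_eq_single _ 1]
  · have : A.indicator (1 : X → ℝ) ⁻¹' {1} = A := by
      ext x; by_cases h : x ∈ A <;> simp [h]
    rw [this, one_mul]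
  · intro r hr
    by_cases h0 : r = 0
    · simp [h0]
    · have : A.indicator (1 : X → ℝ) ⁻¹' {r} = ∅ := by
        ext x; by_cases h : x ∈ A <;> simp [h, Ne.symm hr, Ne.symm h0]
      simp [this]

theorem simpleIntegral_mono (h𝒜 : IsSetAlgebra 𝒜) {μ : AddContent ℝ 𝒜} (hμ : μ ∈ pba 𝒜)
    {s t : X → ℝ} (hs : s ∈ simpleFunctions 𝒜) (ht : t ∈ simpleFunctions 𝒜)
    (hst : ∀ x, s x ≤ t x) : simpleIntegral μ s ≤ simpleIntegral μ t := by
  rw [simpleIntegral_pair h𝒜 μ hs ht (fun a _ => a) (u := s) fun _ => rfl,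
    simpleIntegral_pair h𝒜 μ hs ht (fun _ b => b) (u := t) fun _ => rfl]
  refine Finset.sum_le_sum fun p _ => ?_
  rcases (s ⁻¹' {p.1} ∩ t ⁻¹' {p.2}).eq_empty_or_nonempty with h | ⟨x, hx1, hx2⟩
  · simp [h]
  · refine mul_le_mul_of_nonneg_right ?_ (hμ.1 _ (h𝒜.inter_mem
      ((preimage_mem_of_simple h𝒜 hs).2 _) ((preimage_mem_of_simple h𝒜 ht).2 _)))
    simp only [mem_preimage, mem_singleton_iff] at hx1 hx2
    rw [← hx1, ← hx2]
    exact hst x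

theorem const_mem_simple (h𝒜 : IsSetAlgebra 𝒜) (c : ℝ) :
    c • (univ : Set X).indicator (1 : X → ℝ) ∈ simpleFunctions 𝒜 :=
  Submodule.smul_mem _ _ (Submodule.subset_span ⟨univ, h𝒜.univ_mem, rfl⟩)

/-- If a simple function is uniformly `ε`-close to `f`, then its integral is `ε`-close to that
of `f`. -/
theorem abs_chargeIntegral_sub_le (h𝒜 : IsSetAlgebra 𝒜) {μ : AddContent ℝ 𝒜} (hμ : μ ∈ pba 𝒜)
    {s f : X → ℝ} (hs : s ∈ simpleFunctions 𝒜) {ε : ℝ} (hsf : ∀ x, |f x - s x| ≤ ε) :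
    |chargeIntegral μ f - simpleIntegral μ s| ≤ ε := by
  have hshift : ∀ c : ℝ, s + c • (univ : Set X).indicator (1 : X → ℝ) ∈ simpleFunctions 𝒜 ∧
      simpleIntegral μ (s + c • (univ : Set X).indicator (1 : X → ℝ)) =
        simpleIntegral μ s + c := by
    intro c
    refine ⟨Submodule.add_mem _ hs (const_mem_simple h𝒜 c), ?_⟩
    rw [simpleIntegral_add h𝒜 μ hs (const_mem_simple h𝒜 c), simpleIntegral_smul h𝒜 μ
      (Submodule.subset_span ⟨univ, h𝒜.univ_mem, rfl⟩), simpleIntegral_indicator, hμ.2, mul_one]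
  have hub : ∀ c ∈ {c | ∃ s ∈ simpleFunctions 𝒜, (∀ x, s x ≤ f x) ∧ c = simpleIntegral μ s},
      c ≤ simpleIntegral μ s + ε := by
    rintro _ ⟨t, ht, htf, rfl⟩
    rw [← (hshift ε).2]
    refine simpleIntegral_mono h𝒜 hμ ht (hshift ε).1 fun x => ?_
    have := (abs_le.1 (hsf x)).2
    simp
    linarith [htf x]
  have hmem : simpleIntegral μ s - ε ∈
      {c | ∃ s ∈ simpleFunctions 𝒜, (∀ x, s x ≤ f x) ∧ c = simpleIntegral μ s} := by
    refine ⟨_, (hshift (-ε)).1, fun x => ?_, by rw [(hshift (-ε)).2]; ring⟩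
    have := (abs_le.1 (hsf x)).1
    simp
    linarith
  rw [abs_le]
  constructor
  · have := le_csSup ⟨_, hub⟩ hmem
    unfold chargeIntegral
    linarith
  · have := csSup_le ⟨_, hmem⟩ hub
    unfold chargeIntegral
    linarith

theorem chargeIntegral_eq_simpleIntegral (h𝒜 : IsSetAlgebra 𝒜) {μ : AddContent ℝ 𝒜}
    (hμ : μ ∈ pba 𝒜) {s : X → ℝ} (hs : s ∈ simpleFunctions 𝒜) :
    chargeIntegral μ s = simpleIntegral μ s :=
  sub_eq_zero.1 (abs_nonpos_iff.1 (abs_chargeIntegral_sub_le h𝒜 hμ hs (by simp)))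

theorem tendsto_simpleIntegral (h𝒜 : IsSetAlgebra 𝒜) {μ : AddContent ℝ 𝒜} (hμ : μ ∈ pba 𝒜)
    {f : X → ℝ} {s : ℕ → X → ℝ} (hs : ∀ n, s n ∈ simpleFunctions 𝒜)
    (hsf : TendstoUniformly s f atTop) :
    Tendsto (fun n => simpleIntegral μ (s n)) atTop (𝓝 (chargeIntegral μ f)) := by
  rw [Metric.tendsto_atTop]
  intro ε hε
  obtain ⟨n₀, hn₀⟩ := eventually_atTop.1 (Metric.tendstoUniformly_iff.1 hsf (ε / 2) (half_pos hε))
  refine ⟨n₀, fun n hn => ?_⟩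
  rw [dist_comm, Real.dist_eq]
  exact (abs_chargeIntegral_sub_le h𝒜 hμ (hs n) fun x => (hn₀ n hn x).le).trans_lt
    (half_lt_self hε)

end Charges

/-! ### Type spaces -/

/-- A type space with state space `Ω` and player set `N`. -/
structure TypeSpace (Ω N : Type*) where
  /-- the field `𝒜` of all considered events -/
  events : Set (Set Ω)
  /-- the knowledge field `ℳ i` of player `i` -/
  knowledge : N → Set (Set Ω)
  /-- the belief `t i ω` of player `i` at the state `ω` -/
  belief : N → Ω → AddContent ℝ events
  isSetAlgebra_events : IsSetAlgebra events
  isSetAlgebra_knowledge : ∀ i, IsSetAlgebra (knowledge i)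
  knowledge_subset : ∀ i, knowledge i ⊆ events
  belief_mem : ∀ i ω, belief i ω ∈ pba events
  belief_integrable : ∀ i, ∀ E ∈ events, (fun ω => belief i ω E) ∈ integrableFunctions (knowledge i)
  belief_known : ∀ i, ∀ E ∈ knowledge i, ∀ ω ∈ E, belief i ω E = 1

namespace TypeSpace

variable {Ω N : Type*} (T : TypeSpace Ω N)

/-- `Π i`, the adequate aggregations of player `i`'s beliefs: the probability charges `P` that are
disintegrable, `P (E ∩ F) = ∫_F t_i(·, E) dP` for all events `E` and all `F` in the knowledge
field of `i`. -/
def adequateAggregations (i : N) : Set (AddContent ℝ T.events) :=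
  {P | P ∈ pba T.events ∧ ∀ E ∈ T.events, ∀ F ∈ T.knowledge i,
    P (E ∩ F) = chargeIntegral P (F.indicator fun ω => T.belief i ω E)}

/-- `S` is an `I`-common certainty component. -/
def IsCommonCertaintyComponent (I : Set N) (S : Set Ω) : Prop :=
  S.Nonempty ∧ ∃ E ∈ T.events, E ⊆ S ∧ ∀ ω ∈ S, ∀ i ∈ I, T.belief i ω E = 1

/-- The set `E` is `I`-commonly certain at the state `ω`. -/
def IsCommonlyCertain (I : Set N) (E : Set Ω) (ω : Ω) : Prop :=
  ∃ S, T.IsCommonCertaintyComponent I S ∧ ω ∈ S ∧ S ⊆ E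

/-- The players' beliefs are universally consistent. (For `I = ∅` the intersection of the `Π i` is
the set of all probability charges.) -/
def UniversallyConsistent : Prop :=
  ∀ I : Finset N, ∀ S : Set Ω, T.IsCommonCertaintyComponent I S →
    ∃ P ∈ pba T.events, (∀ i ∈ I, P ∈ T.adequateAggregations i) ∧ 0 < outerWeight P S

/-- A bet among the players of the nonempty finite set `I`. -/
structure IsBet (I : Finset N) (f : I → Ω → ℝ) : Prop where
  nonempty : I.Nonempty
  integrable : ∀ i, f i ∈ integrableFunctions T.events
  sum_eq_zero : ∀ ω, ∑ i, f i ω = 0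

/-- The bet `f` is weakly agreeable: at every state it is `I`-commonly certain that every player
in `I` has nonnegative expected payoff, and for some `α > 0` there is a state at which it is
`I`-commonly certain that every player in `I` has expected payoff at least `α`. -/
structure IsWeaklyAgreeableBet (I : Finset N) (f : I → Ω → ℝ) : Prop extends T.IsBet I f where
  nonneg : ∀ ω, T.IsCommonlyCertain I {ω' | ∀ i : I, 0 ≤ chargeIntegral (T.belief i ω') (f i)} ω
  pos : ∃ ω, ∃ α > 0,
    T.IsCommonlyCertain I {ω' | ∀ i : I, α ≤ chargeIntegral (T.belief i ω') (f i)} ω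

end TypeSpace

end BeliefConsistency

end

noncomputable section

namespace BeliefConsistency

/-! ### Integration against probability charges -/

section Integral

variable {X : Type*} {𝒜 ℬ : Set (Set X)}

/-! Probability charges are the positive normalized functionals on `B(Ω, 𝒜)`. Player `i`'s beliefs
give a positive idempotent operator `E_i f = ∫ f dt_i`, and `P ∈ Π i` exactly when `∫ E_i f dP = ∫ f
dP` for all `f` (`integral_expectation`, `mem_adequateAggregations`).

If beliefs are consistent, a charge `P` that is adequate for all of `I` gives each side of a weakly
agreeable bet the integral `∫ E_i f_i dP > 0`, although the `f_i` sum to zero.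

Conversely, let `E ⊆ S` witness a component and let `L` be the space of all sums `∑ (u_i - E_i
u_i)`. A charge is adequate for all of `I` when it annihilates `L`. Put `w = 2·1_E - 1`. If no `h ∈
L` lies above `w`, Riesz extension (`exists_positive_functional`) yields a charge `P` annihilating
`L` with `∫ w dP ≥ 0`, so `P(E) ≥ 1/2`.

If some `h ∈ L` lies above `w`, spread it evenly over the `n` players: `g_i = E_i u_i - u_i + h/n`
sum to zero and `E_i g_i = E_i h / n ≥ E_i w / n`. This is `1/n` where `t_i(·, E) = 1`. Since
`t_i(·, E)` takes only the values 0 and 1 (`belief_eq_zero_or_one`), cutting the `g_i` off outside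
`E` makes the bet weakly agreeable. -/

theorem mem_integrableFunctions_iff {f : X → ℝ} :
    f ∈ integrableFunctions 𝒜 ↔ ∀ ε > 0, ∃ s ∈ simpleFunctions 𝒜, ∀ x, |f x - s x| ≤ ε := by
  constructor
  · rintro ⟨s, hs, hsf⟩ ε hε
    obtain ⟨n, hn⟩ := (Metric.tendstoUniformly_iff.1 hsf ε hε).exists
    exact ⟨s n, hs n, fun x => (hn x).le⟩
  · intro h
    choose s hs hsf using fun n : ℕ => h (1 / ((n : ℝ) + 1)) Nat.one_div_pos_of_nat
    refine ⟨s, hs, Metric.tendstoUniformly_iff.2 fun ε hε => ?_⟩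
    filter_upwards [(tendsto_one_div_add_atTop_nhds_zero_nat (𝕜 := ℝ)).eventually
      (gt_mem_nhds hε)] with n hn x
    exact (hsf n x).trans_lt hn

theorem mem_integrableFunctions_of_approx {f : X → ℝ}
    (h : ∀ ε > 0, ∃ g ∈ integrableFunctions 𝒜, ∀ x, |f x - g x| ≤ ε) :
    f ∈ integrableFunctions 𝒜 := by
  refine mem_integrableFunctions_iff.2 fun ε hε => ?_
  obtain ⟨g, hg, hfg⟩ := h (ε / 2) (half_pos hε)
  obtain ⟨s, hs, hgs⟩ := mem_integrableFunctions_iff.1 hg (ε / 2) (half_pos hε)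
  refine ⟨s, hs, fun x => ?_⟩
  linarith [abs_sub_le (f x) (g x) (s x), hfg x, hgs x]

theorem simpleFunctions_subset_integrableFunctions :
    (simpleFunctions 𝒜 : Set (X → ℝ)) ⊆ integrableFunctions 𝒜 := fun s hs =>
  mem_integrableFunctions_iff.2 fun ε hε => ⟨s, hs, by simp [hε.le]⟩

theorem simpleFunctions_mono (h : ℬ ⊆ 𝒜) : simpleFunctions ℬ ≤ simpleFunctions 𝒜 :=
  Submodule.span_mono fun _ ⟨A, hA, hg⟩ => ⟨A, h hA, hg⟩

theorem integrableFunctions_mono (h : ℬ ⊆ 𝒜) : integrableFunctions ℬ ⊆ integrableFunctions 𝒜 :=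
  fun _ ⟨s, hs, hsf⟩ => ⟨s, fun n => simpleFunctions_mono h (hs n), hsf⟩

/-- `B(X, 𝒜)` as a vector space. -/
def integrableSubmodule (𝒜 : Set (Set X)) : Submodule ℝ (X → ℝ) where
  carrier := integrableFunctions 𝒜
  zero_mem' := simpleFunctions_subset_integrableFunctions (Submodule.zero_mem _)
  add_mem' := by
    intro f g hf hg
    refine mem_integrableFunctions_iff.2 fun ε hε => ?_
    obtain ⟨s, hs, hfs⟩ := mem_integrableFunctions_iff.1 hf (ε / 2) (half_pos hε)
    obtain ⟨t, ht, hgt⟩ := mem_integrableFunctions_iff.1 hg (ε / 2) (half_pos hε)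
    refine ⟨s + t, Submodule.add_mem _ hs ht, fun x => ?_⟩
    have : (f + g) x - (s + t) x = (f x - s x) + (g x - t x) := by simp; ring
    rw [this]
    linarith [abs_add_le (f x - s x) (g x - t x), hfs x, hgt x]
  smul_mem' := by
    intro c f hf
    refine mem_integrableFunctions_iff.2 fun ε hε => ?_
    have hc : 0 < |c| + 1 := by positivity
    obtain ⟨s, hs, hfs⟩ := mem_integrableFunctions_iff.1 hf (ε / (|c| + 1)) (div_pos hε hc)
    refine ⟨c • s, Submodule.smul_mem _ c hs, fun x => ?_⟩
    have : (c • f) x - (c • s) x = c * (f x - s x) := by simp; ring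
    rw [this, abs_mul]
    calc |c| * |f x - s x| ≤ (|c| + 1) * (ε / (|c| + 1)) := by
          gcongr
          · linarith
          · exact hfs x
      _ = ε := by field_simp

/-- The characteristic function of a member of `𝒜`, as an element of `B(X, 𝒜)`. -/
def charFun {A : Set X} (hA : A ∈ 𝒜) : integrableSubmodule 𝒜 :=
  ⟨A.indicator 1, simpleFunctions_subset_integrableFunctions (Submodule.subset_span ⟨A, hA, rfl⟩)⟩

theorem charFun_apply_of_mem {A : Set X} (hA : A ∈ 𝒜) {x : X} (hx : x ∈ A) :
    (charFun hA : X → ℝ) x = 1 := by simp [charFun, hx]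

theorem charFun_apply_of_notMem {A : Set X} (hA : A ∈ 𝒜) {x : X} (hx : x ∉ A) :
    (charFun hA : X → ℝ) x = 0 := by simp [charFun, hx]

theorem charFun_nonneg {A : Set X} (hA : A ∈ 𝒜) (x : X) : 0 ≤ (charFun hA : X → ℝ) x :=
  indicator_nonneg (fun _ _ => zero_le_one) x

theorem exists_abs_le_of_integrable (h𝒜 : IsSetAlgebra 𝒜) {f : X → ℝ}
    (hf : f ∈ integrableFunctions 𝒜) : ∃ C, ∀ x, |f x| ≤ C := by
  obtain ⟨s, hs, hfs⟩ := mem_integrableFunctions_iff.1 hf 1 one_pos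
  obtain ⟨C, hC⟩ := ((preimage_mem_of_simple h𝒜 hs).1.image abs).bddAbove
  refine ⟨C + 1, fun x => ?_⟩
  have h1 : |s x| ≤ C := hC ⟨s x, ⟨x, rfl⟩, rfl⟩
  have h2 := abs_add_le (f x - s x) (s x)
  rw [sub_add_cancel] at h2
  linarith [hfs x]

/-- The integral with respect to a probability charge, as a linear functional on `B(X, 𝒜)`. -/
def integral (h𝒜 : IsSetAlgebra 𝒜) {μ : AddContent ℝ 𝒜} (hμ : μ ∈ pba 𝒜) :
    integrableSubmodule 𝒜 →ₗ[ℝ] ℝ where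
  toFun f := chargeIntegral μ f
  map_add' := by
    rintro ⟨f, s, hs, hsf⟩ ⟨g, t, ht, htg⟩
    refine tendsto_nhds_unique (tendsto_simpleIntegral h𝒜 hμ (s := s + t)
      (fun n => Submodule.add_mem _ (hs n) (ht n)) (hsf.add htg)) ?_
    exact ((tendsto_simpleIntegral h𝒜 hμ hs hsf).add
      (tendsto_simpleIntegral h𝒜 hμ ht htg)).congr
      fun n => (simpleIntegral_add h𝒜 μ (hs n) (ht n)).symm
  map_smul' := by
    rintro c ⟨f, s, hs, hsf⟩
    refine tendsto_nhds_unique (tendsto_simpleIntegral h𝒜 hμ (s := fun n => c • s n)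
      (fun n => Submodule.smul_mem _ c (hs n)) ?_) ?_
    · exact (uniformContinuous_const_smul c).comp_tendstoUniformly hsf
    · exact ((tendsto_simpleIntegral h𝒜 hμ hs hsf).const_mul c).congr
        fun n => (simpleIntegral_smul h𝒜 μ (hs n) c).symm

theorem integral_apply (h𝒜 : IsSetAlgebra 𝒜) {μ : AddContent ℝ 𝒜} (hμ : μ ∈ pba 𝒜)
    (f : integrableSubmodule 𝒜) : integral h𝒜 hμ f = chargeIntegral μ f := rfl

theorem integral_charFun (h𝒜 : IsSetAlgebra 𝒜) {μ : AddContent ℝ 𝒜} (hμ : μ ∈ pba 𝒜)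
    {A : Set X} (hA : A ∈ 𝒜) : integral h𝒜 hμ (charFun hA) = μ A :=
  (chargeIntegral_eq_simpleIntegral h𝒜 hμ (Submodule.subset_span ⟨A, hA, rfl⟩)).trans
    (simpleIntegral_indicator μ A)

/-- A linear functional on a function space is positive if it is nonnegative on nonnegative
functions. -/
def IsPositive {V : Submodule ℝ (X → ℝ)} (φ : V →ₗ[ℝ] ℝ) : Prop :=
  ∀ f : V, (∀ x, 0 ≤ (f : X → ℝ) x) → 0 ≤ φ f

theorem IsPositive.mono {V : Submodule ℝ (X → ℝ)} {φ : V →ₗ[ℝ] ℝ} (hφ : IsPositive φ)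
    {f g : V} (hfg : ∀ x, (f : X → ℝ) x ≤ (g : X → ℝ) x) : φ f ≤ φ g := by
  rw [← sub_nonneg, ← map_sub]
  exact hφ _ fun x => sub_nonneg.2 (hfg x)

theorem integral_isPositive (h𝒜 : IsSetAlgebra 𝒜) {μ : AddContent ℝ 𝒜} (hμ : μ ∈ pba 𝒜) :
    IsPositive (integral h𝒜 hμ) := by
  intro f hf
  obtain ⟨C, hC⟩ := exists_abs_le_of_integrable h𝒜 f.2
  -- The zero function competes in the supremum; boundedness of `f` keeps that supremum finite.
  refine le_csSup ⟨simpleIntegral μ (C • (univ : Set X).indicator (1 : X → ℝ)), ?_⟩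
    ⟨0, Submodule.zero_mem _, hf, ?_⟩
  · rintro _ ⟨s, hs, hsf, rfl⟩
    refine simpleIntegral_mono h𝒜 hμ hs (const_mem_simple h𝒜 C) fun x => ?_
    simpa using (hsf x).trans ((le_abs_self _).trans (hC x))
  · simpa using (simpleIntegral_smul h𝒜 μ (Submodule.zero_mem _) 0).symm

/-- Positive functionals on `B(X, 𝒜)` are determined by their values on characteristic
functions. -/
theorem IsPositive.ext_charFun (h𝒜 : IsSetAlgebra 𝒜) {φ ψ : integrableSubmodule 𝒜 →ₗ[ℝ] ℝ}
    (hφ : IsPositive φ) (hψ : IsPositive ψ)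
    (h : ∀ (A : Set X) (hA : A ∈ 𝒜), φ (charFun hA) = ψ (charFun hA)) : φ = ψ := by
  have hsimple : ∀ s (hs : s ∈ simpleFunctions 𝒜),
      φ ⟨s, simpleFunctions_subset_integrableFunctions hs⟩ =
        ψ ⟨s, simpleFunctions_subset_integrableFunctions hs⟩ := by
    intro s hs
    induction hs using Submodule.span_induction with
    | mem g hg =>
      obtain ⟨A, hA, rfl⟩ := hg
      exact h A hA
    | zero => exact (map_zero φ).trans (map_zero ψ).symm
    | add s t hs ht hs' ht' =>
      have := congrArg₂ (· + ·) hs' ht'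
      simp only [← map_add] at this
      exact this
    | smul c s hs hs' =>
      have := congrArg (c • ·) hs'
      simp only [← map_smul] at this
      exact this
  -- A positive functional is bounded by the sup norm times its value at the constant 1, so
  -- agreement on simple functions survives uniform limits.
  have hle : ∀ {χ : integrableSubmodule 𝒜 →ₗ[ℝ] ℝ}, IsPositive χ →
      ∀ {f : integrableSubmodule 𝒜} {ε : ℝ}, (∀ x, |(f : X → ℝ) x| ≤ ε) →
        |χ f| ≤ ε * χ (charFun h𝒜.univ_mem) := by
    intro χ hχ f ε hf
    rw [← smul_eq_mul, ← map_smul, abs_le, ← map_neg]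
    constructor <;> refine hχ.mono fun x => ?_
    · simpa [charFun] using (abs_le.1 (hf x)).1
    · simpa [charFun] using (abs_le.1 (hf x)).2
  ext f
  set c := φ (charFun h𝒜.univ_mem) + ψ (charFun h𝒜.univ_mem) with hc
  have hc0 : 0 ≤ c := add_nonneg (hφ _ (charFun_nonneg _)) (hψ _ (charFun_nonneg _))
  refine eq_of_abs_sub_nonpos (le_of_forall_pos_le_add fun δ hδ => ?_)
  have hc1 : 0 < c + 1 := by linarith
  obtain ⟨s, hs, hfs⟩ := mem_integrableFunctions_iff.1 f.2 (δ / (c + 1)) (div_pos hδ hc1)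
  let s' : integrableSubmodule 𝒜 := ⟨s, simpleFunctions_subset_integrableFunctions hs⟩
  have h1 := hle hφ (f := f - s') hfs
  have h2 := hle hψ (f := f - s') hfs
  rw [map_sub] at h1 h2
  have h3 : φ s' = ψ s' := hsimple s hs
  have h4 : φ f - ψ f = (φ f - φ s') - (ψ f - ψ s') := by rw [h3]; ring
  have h5 : δ / (c + 1) * c ≤ δ := by
    rw [div_mul_eq_mul_div, div_le_iff₀ hc1]
    nlinarith
  rw [h4]
  calc |(φ f - φ s') - (ψ f - ψ s')| ≤ |φ f - φ s'| + |ψ f - ψ s'| := abs_sub _ _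
    _ ≤ δ / (c + 1) * c := by rw [hc, mul_add]; exact add_le_add h1 h2
    _ ≤ 0 + δ := by linarith

/-! ### Restriction to an event -/

/-- Restriction to a member of `𝒜`, as a linear map on `B(X, 𝒜)`. -/
def restrict (h𝒜 : IsSetAlgebra 𝒜) {E : Set X} (hE : E ∈ 𝒜) :
    integrableSubmodule 𝒜 →ₗ[ℝ] integrableSubmodule 𝒜 where
  toFun f := ⟨E.indicator f, by
    have hsimple : ∀ s ∈ simpleFunctions 𝒜, E.indicator s ∈ simpleFunctions 𝒜 := by
      intro s hs
      induction hs using Submodule.span_induction with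
      | mem g hg =>
        obtain ⟨A, hA, rfl⟩ := hg
        exact Submodule.subset_span ⟨E ∩ A, h𝒜.inter_mem hE hA, by rw [indicator_indicator]⟩
      | zero => simp
      | add s t _ _ hs ht => rw [indicator_add']; exact Submodule.add_mem _ hs ht
      | smul c s _ hs =>
        rw [show E.indicator (c • s) = c • E.indicator s from indicator_const_smul E c s]
        exact Submodule.smul_mem _ c hs
    refine mem_integrableFunctions_iff.2 fun ε hε => ?_
    obtain ⟨s, hs, hfs⟩ := mem_integrableFunctions_iff.1 f.2 ε hε
    refine ⟨_, hsimple s hs, fun x => ?_⟩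
    by_cases hx : x ∈ E
    · simpa [hx] using hfs x
    · simpa [hx] using hε.le⟩
  map_add' f g := Subtype.ext (indicator_add' _ _ _)
  map_smul' c f := Subtype.ext (indicator_const_smul E c (f : X → ℝ))

theorem restrict_charFun (h𝒜 : IsSetAlgebra 𝒜) {E A : Set X} (hE : E ∈ 𝒜) (hA : A ∈ 𝒜) :
    restrict h𝒜 hE (charFun hA) = charFun (h𝒜.inter_mem hE hA) :=
  Subtype.ext (indicator_indicator E A 1)

theorem IsPositive.comp_restrict (h𝒜 : IsSetAlgebra 𝒜) {E : Set X} (hE : E ∈ 𝒜)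
    {φ : integrableSubmodule 𝒜 →ₗ[ℝ] ℝ} (hφ : IsPositive φ) :
    IsPositive (φ ∘ₗ restrict h𝒜 hE) :=
  fun f hf => hφ _ fun x => indicator_nonneg (f := (f : X → ℝ)) (fun y _ => hf y) x

theorem charge_mono (h𝒜 : IsSetAlgebra 𝒜) {μ : AddContent ℝ 𝒜} (hμ : μ ∈ pba 𝒜) {A B : Set X}
    (hA : A ∈ 𝒜) (hB : B ∈ 𝒜) (hAB : A ⊆ B) : μ A ≤ μ B := by
  rw [← integral_charFun h𝒜 hμ hA, ← integral_charFun h𝒜 hμ hB]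
  exact (integral_isPositive h𝒜 hμ).mono fun x =>
    indicator_le_indicator_of_subset hAB (fun _ => zero_le_one) x

theorem charge_compl (h𝒜 : IsSetAlgebra 𝒜) {μ : AddContent ℝ 𝒜} (hμ : μ ∈ pba 𝒜) {A : Set X}
    (hA : A ∈ 𝒜) : μ Aᶜ = 1 - μ A := by
  have := addContent_union (m := μ) h𝒜.isSetRing hA (h𝒜.compl_mem hA) disjoint_compl_right
  rw [union_compl_self, hμ.2] at this
  linarith

theorem charge_inter_of_null (h𝒜 : IsSetAlgebra 𝒜) {μ : AddContent ℝ 𝒜} (hμ : μ ∈ pba 𝒜)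
    {E A : Set X} (hE : E ∈ 𝒜) (hA : A ∈ 𝒜) (h : μ E = 0) : μ (E ∩ A) = 0 :=
  le_antisymm (h ▸ charge_mono h𝒜 hμ (h𝒜.inter_mem hE hA) hE inter_subset_left)
    (hμ.1 _ (h𝒜.inter_mem hE hA))

theorem charge_inter_of_full (h𝒜 : IsSetAlgebra 𝒜) {μ : AddContent ℝ 𝒜} (hμ : μ ∈ pba 𝒜)
    {E A : Set X} (hE : E ∈ 𝒜) (hA : A ∈ 𝒜) (h : μ E = 1) : μ (E ∩ A) = μ A := by
  have h1 := charge_inter_of_null h𝒜 hμ (h𝒜.compl_mem hE) hA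
    (by rw [charge_compl h𝒜 hμ hE, h, sub_self])
  have h2 := addContent_union (m := μ) h𝒜.isSetRing (h𝒜.inter_mem hE hA)
    (h𝒜.inter_mem (h𝒜.compl_mem hE) hA)
    (disjoint_compl_right.mono inter_subset_left inter_subset_left)
  rw [← union_inter_distrib_right, union_compl_self, univ_inter, h1, add_zero] at h2
  exact h2.symm

theorem integral_restrict_of_null (h𝒜 : IsSetAlgebra 𝒜) {μ : AddContent ℝ 𝒜} (hμ : μ ∈ pba 𝒜)
    {E : Set X} (hE : E ∈ 𝒜) (h : μ E = 0) (f : integrableSubmodule 𝒜) :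
    integral h𝒜 hμ (restrict h𝒜 hE f) = 0 := by
  have : integral h𝒜 hμ ∘ₗ restrict h𝒜 hE = 0 := by
    refine IsPositive.ext_charFun h𝒜 ((integral_isPositive h𝒜 hμ).comp_restrict h𝒜 hE)
      (fun _ _ => le_rfl) fun A hA => ?_
    rw [LinearMap.comp_apply, restrict_charFun, integral_charFun,
      charge_inter_of_null h𝒜 hμ hE hA h, LinearMap.zero_apply]
  exact LinearMap.congr_fun this f

theorem integral_restrict_of_full (h𝒜 : IsSetAlgebra 𝒜) {μ : AddContent ℝ 𝒜} (hμ : μ ∈ pba 𝒜)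
    {E : Set X} (hE : E ∈ 𝒜) (h : μ E = 1) (f : integrableSubmodule 𝒜) :
    integral h𝒜 hμ (restrict h𝒜 hE f) = integral h𝒜 hμ f := by
  have : integral h𝒜 hμ ∘ₗ restrict h𝒜 hE = integral h𝒜 hμ := by
    refine IsPositive.ext_charFun h𝒜 ((integral_isPositive h𝒜 hμ).comp_restrict h𝒜 hE)
      (integral_isPositive h𝒜 hμ) fun A hA => ?_
    rw [LinearMap.comp_apply, restrict_charFun, integral_charFun, integral_charFun,
      charge_inter_of_full h𝒜 hμ hE hA h]
  exact LinearMap.congr_fun this f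

/-! ### Representation and separation of functionals -/

/-- Every positive normalized functional on `B(X, 𝒜)` is the integral with respect to a probability
charge. -/
theorem exists_integral_eq (h𝒜 : IsSetAlgebra 𝒜) {φ : integrableSubmodule 𝒜 →ₗ[ℝ] ℝ}
    (hφ : IsPositive φ) (h1 : φ (charFun h𝒜.univ_mem) = 1) :
    ∃ (μ : AddContent ℝ 𝒜) (hμ : μ ∈ pba 𝒜), integral h𝒜 hμ = φ := by
  classical
  let m : Set X → ℝ := fun A => if hA : A ∈ 𝒜 then φ (charFun hA) else 0
  have hm : ∀ {A : Set X} (hA : A ∈ 𝒜), m A = φ (charFun hA) := fun hA => dif_pos hA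
  let μ : AddContent ℝ 𝒜 := h𝒜.isSetRing.addContent_of_union m
    (by
      rw [hm h𝒜.empty_mem, ← map_zero φ]
      exact congrArg φ (Subtype.ext (indicator_empty _)))
    (by
      intro A B hA hB hAB
      rw [hm hA, hm hB, hm (h𝒜.union_mem hA hB), ← map_add]
      exact congrArg φ (Subtype.ext (indicator_union_of_disjoint hAB _)))
  have hμ : μ ∈ pba 𝒜 :=
    ⟨fun A hA => (hφ _ (charFun_nonneg hA)).trans_eq (hm hA).symm, (hm h𝒜.univ_mem).trans h1⟩
  exact ⟨μ, hμ, IsPositive.ext_charFun h𝒜 (integral_isPositive h𝒜 hμ) hφ fun A hA =>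
    (integral_charFun h𝒜 hμ hA).trans (hm hA)⟩

/-- Separation in `B(X, 𝒜)`: if no member of the subspace `L` lies above `w`, then some positive
normalized functional vanishes on `L` and is nonnegative at `w`. -/
theorem exists_positive_functional (h𝒜 : IsSetAlgebra 𝒜) [Nonempty X]
    (L : Submodule ℝ (integrableSubmodule 𝒜)) {w : integrableSubmodule 𝒜}
    (hw1 : ∀ x, (w : X → ℝ) x ≤ 1)
    (hw : ∀ h ∈ L, ∃ x, (h : X → ℝ) x < (w : X → ℝ) x) :
    ∃ φ : integrableSubmodule 𝒜 →ₗ[ℝ] ℝ, IsPositive φ ∧ φ (charFun h𝒜.univ_mem) = 1 ∧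
      (∀ h ∈ L, φ h = 0) ∧ 0 ≤ φ w := by
  set e : integrableSubmodule 𝒜 := charFun h𝒜.univ_mem with he
  have hex : ∀ x, (e : X → ℝ) x = 1 := fun x => charFun_apply_of_mem _ (mem_univ x)
  -- The functions lying above some member of `L + ℝ≥0 · w`. A functional nonnegative on this cone
  -- is positive, nonnegative at `w`, and zero on `L`, since `L` is a subspace.
  let K : PointedCone ℝ (integrableSubmodule 𝒜) :=
    { carrier := {f | ∃ h ∈ L, ∃ l : ℝ, 0 ≤ l ∧
        ∀ x, (h : X → ℝ) x + l * (w : X → ℝ) x ≤ (f : X → ℝ) x}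
      zero_mem' := ⟨0, L.zero_mem, 0, le_rfl, fun x => by simp⟩
      add_mem' := by
        rintro f g ⟨h, hh, l, hl, hf⟩ ⟨k, hk, m, hm, hg⟩
        refine ⟨h + k, L.add_mem hh hk, l + m, add_nonneg hl hm, fun x => ?_⟩
        have := add_le_add (hf x) (hg x)
        simp only [Submodule.coe_add, Pi.add_apply]
        linarith
      smul_mem' := by
        rintro ⟨c, hc⟩ f ⟨h, hh, l, hl, hf⟩
        refine ⟨c • h, L.smul_mem c hh, c * l, mul_nonneg hc hl, fun x => ?_⟩
        have := mul_le_mul_of_nonneg_left (hf x) hc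
        change c * (h : X → ℝ) x + c * l * (w : X → ℝ) x ≤ c * (f : X → ℝ) x
        linarith }
  have he0 : e ≠ 0 := by
    intro h
    obtain ⟨x⟩ := ‹Nonempty X›
    have := hex x
    rw [h] at this
    simp at this
  have hcone : ∀ c : ℝ, c • e ∈ K → 0 ≤ c := by
    rintro c ⟨h, hh, l, hl, hf⟩
    by_contra! hc
    have hf' : ∀ x, (h : X → ℝ) x + l * (w : X → ℝ) x ≤ c := fun x => by
      have := hf x
      simpa [hex] using this
    -- A negative constant above `h + l w` would put a member of `L` above `w`: `c⁻¹ h ≥ 1 ≥ w` if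
    -- `l = 0`, and `-h/l ≥ w` if `l > 0`.
    rcases hl.eq_or_lt with rfl | hl
    · obtain ⟨x, hx⟩ := hw (c⁻¹ • h) (L.smul_mem _ hh)
      have h1 : (h : X → ℝ) x ≤ c := by simpa using hf' x
      have h2 : 1 ≤ c⁻¹ * (h : X → ℝ) x := by
        rw [← inv_mul_cancel₀ hc.ne]
        exact mul_le_mul_of_nonpos_left h1 (inv_nonpos.2 hc.le)
      have h3 : c⁻¹ * (h : X → ℝ) x < (w : X → ℝ) x := hx
      linarith [hw1 x]
    · obtain ⟨x, hx⟩ := hw (-(l⁻¹ • h)) (L.neg_mem (L.smul_mem _ hh))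
      have h1 := hf' x
      have h2 : -(l⁻¹ * (h : X → ℝ) x) < (w : X → ℝ) x := hx
      have h3 := mul_lt_mul_of_pos_left h2 hl
      rw [mul_neg, ← mul_assoc, mul_inv_cancel₀ hl.ne', one_mul] at h3
      linarith
  obtain ⟨φ, hφ, hφK⟩ := riesz_extension K
    (LinearPMap.mkSpanSingleton (σ := RingHom.id ℝ) e (1 : ℝ) he0)
    (by
      rintro ⟨y, hy⟩ hyK
      obtain ⟨c, rfl⟩ := Submodule.mem_span_singleton.1 hy
      rw [LinearPMap.mkSpanSingleton'_apply]
      simpa using hcone c hyK)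
    (by
      -- Constants are cofinal because integrable functions are bounded.
      intro y
      obtain ⟨C, hC⟩ := exists_abs_le_of_integrable h𝒜 y.2
      refine ⟨⟨C • e, Submodule.mem_span_singleton.2 ⟨C, rfl⟩⟩, 0, L.zero_mem, 0, le_rfl,
        fun x => ?_⟩
      have := (abs_le.1 (hC x)).1
      simp [hex]
      linarith)
  have hzero : ∀ h ∈ L, 0 ≤ φ h := fun h hh =>
    hφK h ⟨h, hh, 0, le_rfl, fun x => by simp⟩
  refine ⟨φ, fun f hf => hφK f ⟨0, L.zero_mem, 0, le_rfl, fun x => by simpa using hf x⟩, ?_,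
    fun h hh => ?_, hφK w ⟨0, L.zero_mem, 1, zero_le_one, fun x => by simp⟩⟩
  · have := hφ ⟨e, Submodule.mem_span_singleton_self e⟩
    rw [this]
    exact LinearPMap.mkSpanSingleton_apply ℝ ℝ he0 1
  · have := hzero (-h) (L.neg_mem hh)
    rw [map_neg] at this
    linarith [hzero h hh]

/-! ### Outer weight -/

theorem le_outerWeight (h𝒜 : IsSetAlgebra 𝒜) {μ : AddContent ℝ 𝒜} (hμ : μ ∈ pba 𝒜) {E S : Set X}
    (hE : E ∈ 𝒜) (hES : E ⊆ S) : μ E ≤ outerWeight μ S :=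
  le_csInf ⟨_, univ, h𝒜.univ_mem, subset_univ _, rfl⟩ (by
    rintro _ ⟨F, hF, hSF, rfl⟩
    exact charge_mono h𝒜 hμ hE hF (hES.trans hSF))

theorem outerWeight_le {μ : AddContent ℝ 𝒜} (hμ : μ ∈ pba 𝒜) {E S : Set X}
    (hE : E ∈ 𝒜) (hSE : S ⊆ E) : outerWeight μ S ≤ μ E :=
  csInf_le ⟨0, by rintro _ ⟨F, hF, -, rfl⟩; exact hμ.1 F hF⟩ ⟨E, hE, hSE, rfl⟩

/-- The point mass at an element of `S` gives every event containing `S` weight 1. This settles the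
case of no players. -/
theorem exists_pos_outerWeight_of_nonempty (h𝒜 : IsSetAlgebra 𝒜) {S : Set X} (hS : S.Nonempty) :
    ∃ μ ∈ pba 𝒜, 0 < outerWeight μ S := by
  obtain ⟨x, hx⟩ := hS
  obtain ⟨μ, hμ, h⟩ := exists_integral_eq h𝒜
    (φ := LinearMap.proj x ∘ₗ (integrableSubmodule 𝒜).subtype) (fun f hf => hf x)
    (charFun_apply_of_mem h𝒜.univ_mem (mem_univ x))
  refine ⟨μ, hμ, zero_lt_one.trans_le (le_csInf ⟨_, univ, h𝒜.univ_mem, subset_univ _, rfl⟩ ?_)⟩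
  rintro _ ⟨E, hE, hSE, rfl⟩
  rw [← integral_charFun h𝒜 hμ hE, h]
  exact (charFun_apply_of_mem hE (hSE hx)).ge

/-- A nonnegative integrable function that is bounded away from zero on a set of positive outer
weight has positive integral. -/
theorem integral_pos_of_outerWeight_pos (h𝒜 : IsSetAlgebra 𝒜) {μ : AddContent ℝ 𝒜}
    (hμ : μ ∈ pba 𝒜) {S : Set X} (hS : 0 < outerWeight μ S) {f : integrableSubmodule 𝒜}
    (hf : ∀ x, 0 ≤ (f : X → ℝ) x) {α : ℝ} (hα : 0 < α) (hfS : ∀ x ∈ S, α ≤ (f : X → ℝ) x) :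
    0 < integral h𝒜 hμ f := by
  -- Superlevel sets of `f` need not belong to `𝒜`, those of a simple `s` do. With error `α/4`, the
  -- set `{s ≥ α/2}` contains `S`, and `f ≥ α/4` on it.
  obtain ⟨s, hs, hfs⟩ := mem_integrableFunctions_iff.1 f.2 (α / 4) (by positivity)
  obtain ⟨hfin, hpre⟩ := preimage_mem_of_simple h𝒜 hs
  have hF : s ⁻¹' Ici (α / 2) ∈ 𝒜 := by
    have : s ⁻¹' Ici (α / 2) =
        ⋃ r ∈ hfin.toFinset.filter (fun r => α / 2 ≤ r), s ⁻¹' {r} := by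
      ext x
      simp
    rw [this]
    exact h𝒜.biUnion_mem _ fun r _ => hpre r
  have hSF : S ⊆ s ⁻¹' Ici (α / 2) := fun x hx => by
    have h1 := hfS x hx
    have h2 := (abs_le.1 (hfs x)).2
    simp only [mem_preimage, mem_Ici]
    linarith
  calc 0 < α / 4 * μ (s ⁻¹' Ici (α / 2)) :=
        mul_pos (by positivity) (hS.trans_le (outerWeight_le hμ hF hSF))
    _ = integral h𝒜 hμ ((α / 4) • charFun hF) := by
        rw [map_smul, integral_charFun, smul_eq_mul]
    _ ≤ integral h𝒜 hμ f := by
        refine (integral_isPositive h𝒜 hμ).mono fun x => ?_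
        change α / 4 * (charFun hF : X → ℝ) x ≤ _
        by_cases hx : x ∈ s ⁻¹' Ici (α / 2)
        · rw [charFun_apply_of_mem hF hx]
          have h2 := (abs_le.1 (hfs x)).1
          simp only [mem_preimage, mem_Ici] at hx
          linarith
        · rw [charFun_apply_of_notMem hF hx, mul_zero]
          exact hf x

end Integral

/-! ### Expectation operators and their invariant charges -/

namespace TypeSpace

variable {Ω N : Type*} (T : TypeSpace Ω N)

/-- The integral with respect to the belief of player `i` at `ω`. -/
def beliefIntegral (i : N) (ω : Ω) : integrableSubmodule T.events →ₗ[ℝ] ℝ :=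
  integral T.isSetAlgebra_events (T.belief_mem i ω)

/-- Linearity carries the axiom on `t_i(·, E)` to simple functions. Integrating against probability
charges does not increase uniform distance, which gives the limits. -/
theorem expectation_mem (i : N) (f : integrableSubmodule T.events) :
    (fun ω => T.beliefIntegral i ω f) ∈ integrableFunctions (T.knowledge i) := by
  have hsimple : ∀ s (hs : s ∈ simpleFunctions T.events),
      (fun ω => T.beliefIntegral i ω ⟨s, simpleFunctions_subset_integrableFunctions hs⟩) ∈
        integrableSubmodule (T.knowledge i) := by
    intro s hs
    induction hs using Submodule.span_induction with
    | mem g hg =>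
      obtain ⟨A, hA, rfl⟩ := hg
      convert! T.belief_integrable i A hA using 2 with ω
      exact integral_charFun _ _ hA
    | zero =>
      convert Submodule.zero_mem _ using 2 with ω
      exact map_zero _
    | add s t hs ht hs' ht' =>
      convert Submodule.add_mem _ hs' ht' using 2 with ω
      exact map_add (T.beliefIntegral i ω)
        ⟨s, simpleFunctions_subset_integrableFunctions hs⟩
        ⟨t, simpleFunctions_subset_integrableFunctions ht⟩
    | smul c s hs hs' =>
      convert Submodule.smul_mem _ c hs' using 2 with ω
      exact map_smul (T.beliefIntegral i ω) c
        ⟨s, simpleFunctions_subset_integrableFunctions hs⟩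
  refine mem_integrableFunctions_of_approx fun ε hε => ?_
  obtain ⟨s, hs, hfs⟩ := mem_integrableFunctions_iff.1 f.2 ε hε
  refine ⟨_, hsimple s hs, fun ω => ?_⟩
  have := abs_chargeIntegral_sub_le T.isSetAlgebra_events (T.belief_mem i ω) hs hfs
  rwa [← chargeIntegral_eq_simpleIntegral T.isSetAlgebra_events (T.belief_mem i ω) hs] at this

/-- The expectation operator of player `i`, mapping `f` to `ω ↦ ∫ f dt_i(ω, ·)`. -/
def expectation (i : N) : integrableSubmodule T.events →ₗ[ℝ] integrableSubmodule T.events where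
  toFun f := ⟨fun ω => T.beliefIntegral i ω f,
    integrableFunctions_mono (T.knowledge_subset i) (T.expectation_mem i f)⟩
  map_add' f g := Subtype.ext (funext fun _ => map_add _ f g)
  map_smul' c f := Subtype.ext (funext fun _ => map_smul _ c f)

theorem expectation_charFun (i : N) {A : Set Ω} (hA : A ∈ T.events) (ω : Ω) :
    (T.expectation i (charFun hA) : Ω → ℝ) ω = T.belief i ω A := integral_charFun _ _ hA

theorem expectation_mono (i : N) {f g : integrableSubmodule T.events}
    (hfg : ∀ ω, (f : Ω → ℝ) ω ≤ (g : Ω → ℝ) ω) (ω : Ω) :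
    (T.expectation i f : Ω → ℝ) ω ≤ (T.expectation i g : Ω → ℝ) ω :=
  (integral_isPositive T.isSetAlgebra_events (T.belief_mem i ω)).mono hfg

theorem belief_known_compl (i : N) {F : Set Ω} (hF : F ∈ T.knowledge i) {ω : Ω} (hω : ω ∉ F) :
    T.belief i ω F = 0 := by
  have h1 := T.belief_known i Fᶜ ((T.isSetAlgebra_knowledge i).compl_mem hF) ω hω
  rw [charge_compl T.isSetAlgebra_events (T.belief_mem i ω) (T.knowledge_subset i hF)] at h1
  linarith

/-- On the knowledge field, `t_i(ω, ·)` is the point mass at `ω`. Hence the expectation operator is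
idempotent. -/
theorem beliefIntegral_eq_self (i : N) (ω : Ω) {f : integrableSubmodule T.events}
    (hf : (f : Ω → ℝ) ∈ integrableFunctions (T.knowledge i)) :
    T.beliefIntegral i ω f = (f : Ω → ℝ) ω := by
  let incl : integrableSubmodule (T.knowledge i) →ₗ[ℝ] integrableSubmodule T.events :=
    Submodule.inclusion (integrableFunctions_mono (T.knowledge_subset i))
  let ev : integrableSubmodule (T.knowledge i) →ₗ[ℝ] ℝ :=
    LinearMap.proj ω ∘ₗ (integrableSubmodule (T.knowledge i)).subtype
  have : T.beliefIntegral i ω ∘ₗ incl = ev := by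
    refine IsPositive.ext_charFun (T.isSetAlgebra_knowledge i)
      (fun g hg => integral_isPositive T.isSetAlgebra_events (T.belief_mem i ω) (incl g) hg)
      (fun g hg => hg ω) fun A hA => ?_
    refine (integral_charFun T.isSetAlgebra_events (T.belief_mem i ω)
      (T.knowledge_subset i hA)).trans ?_
    by_cases hω : ω ∈ A
    · exact (T.belief_known i A hA ω hω).trans (charFun_apply_of_mem hA hω).symm
    · exact (T.belief_known_compl i hA hω).trans (charFun_apply_of_notMem hA hω).symm
  exact LinearMap.congr_fun this ⟨f, hf⟩

theorem expectation_expectation (i : N) (f : integrableSubmodule T.events) :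
    T.expectation i (T.expectation i f) = T.expectation i f :=
  Subtype.ext (funext fun ω => T.beliefIntegral_eq_self i ω (T.expectation_mem i f))

/-- The disintegration formula with `F = Ω` is invariance on characteristic functions, and these
determine positive functionals. -/
theorem integral_expectation {i : N} {P : AddContent ℝ T.events}
    (hP : P ∈ T.adequateAggregations i) (f : integrableSubmodule T.events) :
    integral T.isSetAlgebra_events hP.1 (T.expectation i f) =
      integral T.isSetAlgebra_events hP.1 f := by
  have hpos := integral_isPositive T.isSetAlgebra_events hP.1
  have : integral T.isSetAlgebra_events hP.1 ∘ₗ T.expectation i =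
      integral T.isSetAlgebra_events hP.1 := by
    refine IsPositive.ext_charFun T.isSetAlgebra_events
      (fun g hg => hpos _ fun ω => integral_isPositive _ (T.belief_mem i ω) _ hg) hpos
      fun A hA => ?_
    have h := hP.2 A hA univ (T.isSetAlgebra_knowledge i).univ_mem
    rw [inter_univ, indicator_univ] at h
    rw [integral_charFun, h, LinearMap.comp_apply, integral_apply]
    exact congrArg _ (funext fun ω => T.expectation_charFun i hA ω)
  exact LinearMap.congr_fun this f

/-- For `F` in the knowledge field, `1_F · t_i(·, E) = t_i(·, F ∩ E)`, so invariance at the single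
function `1_{F ∩ E}` gives the disintegration formula over `F`. -/
theorem mem_adequateAggregations {i : N} {P : AddContent ℝ T.events} (hP : P ∈ pba T.events)
    (h : ∀ f, integral T.isSetAlgebra_events hP (T.expectation i f) =
      integral T.isSetAlgebra_events hP f) : P ∈ T.adequateAggregations i := by
  refine ⟨hP, fun E hE F hF => ?_⟩
  have hF' := T.knowledge_subset i hF
  have hA := T.isSetAlgebra_events.inter_mem hF' hE
  rw [inter_comm, ← integral_charFun T.isSetAlgebra_events hP hA, ← h, integral_apply]
  refine congrArg _ (funext fun ω => ?_)
  rw [expectation_charFun]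
  by_cases hω : ω ∈ F
  · rw [indicator_of_mem hω, charge_inter_of_full T.isSetAlgebra_events (T.belief_mem i ω) hF' hE
      (T.belief_known i F hF ω hω)]
  · rw [indicator_of_notMem hω, charge_inter_of_null T.isSetAlgebra_events (T.belief_mem i ω) hF' hE
      (T.belief_known_compl i hF hω)]

/-- If player `i` is certain of `E` whenever `E` occurs, then at every state `E` has belief `0`
or `1`. -/
theorem belief_eq_zero_or_one {i : N} {E : Set Ω} (hE : E ∈ T.events)
    (h : ∀ ω ∈ E, T.belief i ω E = 1) (ω : Ω) : T.belief i ω E = 0 ∨ T.belief i ω E = 1 := by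
  refine or_iff_not_imp_left.2 fun h0 => ?_
  have halg := T.isSetAlgebra_events
  refine eq_of_abs_sub_nonpos (le_of_forall_pos_le_add fun ε hε => ?_)
  obtain ⟨s, hs, hfs⟩ := mem_integrableFunctions_iff.1 (T.belief_integrable i E hE) (ε / 2)
    (half_pos hε)
  -- Player `i` is certain at `ω` of this level set. If `E` has positive belief there, the level set
  -- meets `E` at some `ω'`, where the belief is 1; as `s` agrees at `ω` and `ω'`, the belief at `ω`
  -- is within `ε` of 1.
  set F := s ⁻¹' {s ω} with hFdef
  have hF : F ∈ T.knowledge i := (preimage_mem_of_simple (T.isSetAlgebra_knowledge i) hs).2 _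
  have hFE := charge_inter_of_full halg (T.belief_mem i ω) (T.knowledge_subset i hF) hE
    (T.belief_known i F hF ω rfl)
  obtain ⟨ω', hω'F, hω'E⟩ : (F ∩ E).Nonempty := by
    by_contra hne
    rw [not_nonempty_iff_eq_empty.1 hne, addContent_empty] at hFE
    exact h0 hFE.symm
  have h1 := hfs ω
  have h2 := hfs ω'
  rw [h ω' hω'E, show s ω' = s ω from hω'F] at h2
  rw [abs_sub_comm] at h2
  linarith [abs_sub_le (T.belief i ω E) (s ω) 1]

/-! ### The two directions of the equivalence -/

theorem not_weaklyAgreeable_of_consistent (hT : T.UniversallyConsistent) {I : Finset N}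
    {f : I → Ω → ℝ} (hf : T.IsWeaklyAgreeableBet I f) : False := by
  obtain ⟨ω₀, α, hα, S, hS, -, hSα⟩ := hf.pos
  obtain ⟨P, hP, hPI, hPS⟩ := hT I S hS
  let u : I → integrableSubmodule T.events := fun i => ⟨f i, hf.integrable i⟩
  have hpos : ∀ i : I, 0 < integral T.isSetAlgebra_events hP (u i) := by
    intro i
    rw [← T.integral_expectation (hPI i i.2) (u i)]
    refine integral_pos_of_outerWeight_pos T.isSetAlgebra_events hP hPS (fun ω => ?_) hα
      fun ω hω => hSα hω i
    obtain ⟨S', -, hω, hS'⟩ := hf.nonneg ω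
    exact hS' hω i
  have hsum : ∑ i, u i = 0 := by
    refine Subtype.ext (funext fun ω => ?_)
    simpa [u] using hf.sum_eq_zero ω
  have hlt : 0 < ∑ i, integral T.isSetAlgebra_events hP (u i) :=
    Finset.sum_pos (fun i _ => hpos i) (by simpa using hf.nonempty)
  rw [← map_sum, hsum, map_zero] at hlt
  exact hlt.false

/-- The map `u ↦ ∑ i, (u i - expectation i (u i))`. A probability charge whose integral vanishes on
its range is an adequate aggregation for all members of `I`. -/
def defect (I : Finset N) :
    (I → integrableSubmodule T.events) →ₗ[ℝ] integrableSubmodule T.events :=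
  ∑ i : I, (LinearMap.id - T.expectation i) ∘ₗ LinearMap.proj i

theorem defect_apply (I : Finset N) (u : I → integrableSubmodule T.events) :
    T.defect I u = ∑ i : I, (u i - T.expectation i (u i)) := by
  simp [defect]

/-- The case where a member of `L` lies above `w`: the functions `g_i`, cut off outside `E`, form
the bet. -/
theorem exists_weaklyAgreeableBet {I : Finset N} (hI : I.Nonempty) {S E : Set Ω}
    (hS : T.IsCommonCertaintyComponent I S) (hE : E ∈ T.events) (hES : E ⊆ S)
    (hcert : ∀ ω ∈ S, ∀ i ∈ I, T.belief i ω E = 1) {u : I → integrableSubmodule T.events}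
    (hu : ∀ ω, 2 * (charFun hE : Ω → ℝ) ω - 1 ≤ (T.defect I u : Ω → ℝ) ω) :
    ∃ f : I → Ω → ℝ, T.IsWeaklyAgreeableBet I f := by
  have halg := T.isSetAlgebra_events
  set h := T.defect I u with hh
  set n : ℝ := (I.card : ℝ) with hn
  have hn0 : 0 < n := by rw [hn]; exact_mod_cast hI.card_pos
  let g : I → integrableSubmodule T.events := fun i => T.expectation i (u i) - u i + n⁻¹ • h
  have hg : ∑ i, g i = 0 := by
    have h1 : ∑ i : I, (T.expectation i (u i) - u i) = -h := by
      rw [hh, defect_apply, ← Finset.sum_neg_distrib]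
      exact Finset.sum_congr rfl fun i _ => (neg_sub _ _).symm
    rw [Finset.sum_add_distrib, h1, Finset.sum_const, Finset.card_univ, Fintype.card_coe,
      ← Nat.cast_smul_eq_nsmul ℝ, smul_smul, ← hn, mul_inv_cancel₀ hn0.ne', one_smul,
      neg_add_cancel]
  have hzero : ∀ (i : I) (ω : Ω), T.belief i ω E = 0 →
      T.beliefIntegral i ω (restrict halg hE (g i)) = 0 := fun i ω h0 =>
    integral_restrict_of_null halg (T.belief_mem i ω) hE h0 _
  have hone : ∀ (i : I) (ω : Ω), T.belief i ω E = 1 →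
      n⁻¹ ≤ T.beliefIntegral i ω (restrict halg hE (g i)) := by
    intro i ω h1
    have h2 : T.beliefIntegral i ω (restrict halg hE (g i)) = T.beliefIntegral i ω (g i) :=
      integral_restrict_of_full halg (T.belief_mem i ω) hE h1 _
    have h3 : T.expectation i (g i) = n⁻¹ • T.expectation i h := by
      simp only [g, map_add, map_sub, map_smul, expectation_expectation, sub_self, zero_add]
    have h4 : T.beliefIntegral i ω (g i) = n⁻¹ * (T.expectation i h : Ω → ℝ) ω :=
      congrFun (congrArg Subtype.val h3) ω
    -- Apply the monotone expectation operator to `w ≤ h`: where `E` is certain, `w` has expectation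
    -- `2 · 1 - 1 = 1`.
    have h5 : 1 ≤ (T.expectation i h : Ω → ℝ) ω := by
      refine le_trans (le_of_eq ?_)
        (T.expectation_mono i (f := (2 : ℝ) • charFun hE - charFun halg.univ_mem)
          (fun ω' => ?_) ω)
      · rw [map_sub, map_smul]
        change 1 = 2 * (T.expectation i (charFun hE) : Ω → ℝ) ω -
          (T.expectation i (charFun halg.univ_mem) : Ω → ℝ) ω
        rw [expectation_charFun, expectation_charFun, h1, (T.belief_mem i ω).2]
        norm_num
      · change 2 * (charFun hE : Ω → ℝ) ω' - (charFun halg.univ_mem : Ω → ℝ) ω' ≤ _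
        rw [charFun_apply_of_mem halg.univ_mem (mem_univ ω')]
        exact hu ω'
    rw [h2, h4]
    exact le_mul_of_one_le_right (inv_nonneg.2 hn0.le) h5
  refine ⟨fun i => restrict halg hE (g i), ⟨hI, fun i => (restrict halg hE (g i)).2, fun ω => ?_⟩,
    -- Expected payoffs are nonnegative at all states, so the whole space serves as the component.
    fun ω => ⟨univ, ⟨⟨ω, mem_univ ω⟩, univ, halg.univ_mem, subset_rfl,
      fun ω' _ i _ => (T.belief_mem i ω').2⟩, mem_univ ω, fun ω' _ i => ?_⟩, ?_⟩
  · have h1 : ∑ i, restrict halg hE (g i) = 0 := by rw [← map_sum, hg, map_zero]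
    have h2 := congrFun (congrArg Subtype.val h1) ω
    simpa using h2
  · rcases T.belief_eq_zero_or_one hE (fun ω hω => hcert ω (hES hω) i i.2) ω' with h0 | h1
    · exact (hzero i ω' h0).ge
    · exact (inv_nonneg.2 hn0.le).trans (hone i ω' h1)
  · obtain ⟨ω, hω⟩ := hS.1
    exact ⟨ω, n⁻¹, inv_pos.2 hn0, S, hS, hω, fun ω' hω' i => hone i ω' (hcert ω' hω' i i.2)⟩

/-- The complementary case: the separating functional is a charge with `2 P(E) - 1 ≥ 0`. The
constant subtracted in `w` turns this weak inequality into `P(E) > 0`. -/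
theorem exists_pos_outerWeight {I : Finset N} {S : Set Ω}
    (hS : T.IsCommonCertaintyComponent I S) {E : Set Ω} (hE : E ∈ T.events) (hES : E ⊆ S)
    (hno : ∀ u : I → integrableSubmodule T.events,
      ∃ ω, (T.defect I u : Ω → ℝ) ω < 2 * (charFun hE : Ω → ℝ) ω - 1) :
    ∃ P ∈ pba T.events, (∀ i ∈ I, P ∈ T.adequateAggregations i) ∧ 0 < outerWeight P S := by
  classical
  have halg := T.isSetAlgebra_events
  have : Nonempty Ω := hS.1.to_type
  have hwapp : ∀ ω, (((2 : ℝ) • charFun hE - charFun halg.univ_mem :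
      integrableSubmodule T.events) : Ω → ℝ) ω = 2 * (charFun hE : Ω → ℝ) ω - 1 := fun ω => by
    rw [← charFun_apply_of_mem halg.univ_mem (mem_univ ω)]
    rfl
  obtain ⟨φ, hφ, hφ1, hφL, hφE⟩ := exists_positive_functional halg (LinearMap.range (T.defect I))
    (w := (2 : ℝ) • charFun hE - charFun halg.univ_mem)
    (fun ω => by
      rw [hwapp]
      by_cases hω : ω ∈ E
      · rw [charFun_apply_of_mem hE hω]; norm_num
      · rw [charFun_apply_of_notMem hE hω]; norm_num)
    (by
      rintro _ ⟨u, rfl⟩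
      obtain ⟨ω, hω⟩ := hno u
      exact ⟨ω, by rwa [hwapp]⟩)
  obtain ⟨P, hP, rfl⟩ := exists_integral_eq halg hφ hφ1
  refine ⟨P, hP, fun i hi => T.mem_adequateAggregations hP fun f => ?_, ?_⟩
  -- Testing on families supported at one player yields invariance for that player.
  · have h1 := hφL _ ⟨Pi.single ⟨i, hi⟩ f, rfl⟩
    rw [defect_apply, Finset.sum_eq_single ⟨i, hi⟩ (fun j _ hj => by simp [hj]) (by simp),
      Pi.single_eq_same, map_sub] at h1
    linarith
  · rw [map_sub, map_smul, hφ1, integral_charFun, smul_eq_mul] at hφE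
    exact lt_of_lt_of_le (by linarith) (le_outerWeight halg hP hE hES)

end TypeSpace

end BeliefConsistency

end

theorem mainTheorem2 {Ω N : Type*} (T : BeliefConsistency.TypeSpace Ω N) :
    T.UniversallyConsistent ↔
      ¬ ∃ (I : Finset N) (f : I → Ω → ℝ), T.IsWeaklyAgreeableBet I f := by
  refine ⟨fun hT ⟨I, f, hf⟩ => T.not_weaklyAgreeable_of_consistent hT hf, fun hT I S hS => ?_⟩
  obtain ⟨E, hE, hES, hcert⟩ := hS.2
  rcases I.eq_empty_or_nonempty with rfl | hI
  · obtain ⟨P, hP, hPS⟩ :=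
      BeliefConsistency.exists_pos_outerWeight_of_nonempty T.isSetAlgebra_events hS.1
    exact ⟨P, hP, by simp, hPS⟩
  · refine T.exists_pos_outerWeight hS hE hES fun u => ?_
    by_contra! hu
    exact hT ⟨I, T.exists_weaklyAgreeableBet hI hS hE hES hcert hu⟩
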